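/- Let $n>2k\ge 6$ be integers, and write $[i]=\{1,\dots,i\}$, $[2,i]=\{2,\dots,i\}$. For finite sets $A,B$ of positive integers put $A\le B$ if $A\supseteq B$ or the smallest element of $A\setminus B$ is smaller than the smallest element of $B\setminus A$; put $A<B$ if moreover $A\ne B$. For $S\subseteq[n]$ let $$\mathcal L(S,a)=\Big\{A\in\tbinom{[2,n]}{a}: A\le S\cap[2,n]\Big\}.$$ Say that $S\subseteq[n]$ and $T\subseteq[2,n]$ form a \emph{strong pair} if $|S|\le k$, $|T|\le k$ and there is $j$ with $S\cap T=\{j\}$ and $S\cup T=[j]$ (so $j$ is the largest element of both, and $1\in S$). A strong pair $(S,T)$ with largest element $j\ge4$ is \emph{resistant} if either $|[i]\cap S|<|[i]\setminus S|$ for all $4\le i\le j$, or $S=\{1,4\}$ and $T=\{2,3,4\}$. Let $(S_1,T_1),\dots,(S_m,T_m)$ be all the resistant pairs, put $T_0=[2,n]$, and let the numbering be such that $T_0<T_1<\dots<T_m$. A strong pair $(S,T)$ is \emph{$T_l$-neutral} if $T$ is obtained from $T_l$ by finitely many (possibly zero) steps, each of which replaces the current set $T'$ by $T'\cup\{2|T'|\}$.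 \textbf{Theorem.} Let $(S,T)$ be a strong pair, let $\mathcal A=\mathcal L(S,k-1)$ and $\mathcal B=\mathcal L(T,k)$, and suppose that $T_{l-1}<T\le T_l$ for some $l\in\{1,\dots,m\}$. Then $$|\mathcal A|+|\mathcal B|=|\mathcal L(S_l,k-1)|+|\mathcal L(T_l,k)|$$ if and only if the pair $(S,T)$ is $T_l$-neutral. -/

import Mathlib

namespace LexPairs

/-- The (reflexive) lexicographic order on finite sets of positive integers: `A` is at most `B` iff
`A ⊇ B`, or the minimal element of `A \ B` is smaller than the minimal element of `B \ A`. -/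
def LexLE (A B : Finset ℕ) : Prop :=
  B ⊆ A ∨ ∃ a ∈ A \ B, ∀ b ∈ B \ A, a < b

instance (A B : Finset ℕ) : Decidable (LexLE A B) := by
  unfold LexLE
  infer_instance

/-- The strict lexicographic order. -/
def LexLT (A B : Finset ℕ) : Prop :=
  LexLE A B ∧ A ≠ B

/-- The family `𝓛(S, a)` of all `a`-element subsets of `[2, n]` that are lexicographically at most
`S ∩ [2, n]`. -/
def lexFamily (n : ℕ) (S : Finset ℕ) (a : ℕ) : Finset (Finset ℕ) :=
  (Finset.powersetCard a (Finset.Icc 2 n)).filter (fun A => LexLE A (S ∩ Finset.Icc 2 n))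

/-- `S ⊆ [n]` and `T ⊆ [2, n]` have at most `k` elements each and strongly intersect in
their common largest element `j`, that is, `S ∩ T = {j}` and `S ∪ T = [j]`.
(In particular `1 ∈ S`.) -/
structure IsStrongPair (n k j : ℕ) (S T : Finset ℕ) : Prop where
  subset_left : S ⊆ Finset.Icc 1 n
  subset_right : T ⊆ Finset.Icc 2 n
  inter_eq : S ∩ T = {j}
  union_eq : S ∪ T = Finset.Icc 1 j
  card_left : S.card ≤ k
  card_right : T.card ≤ k

/-- `S` and `T` form a resistant pair. -/
def IsResistantPair (n k : ℕ) (S T : Finset ℕ) : Prop :=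
  ∃ j, 4 ≤ j ∧ IsStrongPair n k j S T ∧
    ((∀ i, 4 ≤ i → i ≤ j → (Finset.Icc 1 i ∩ S).card < (Finset.Icc 1 i \ S).card) ∨
      (S = {1, 4} ∧ T = {2, 3, 4}))

/-- `(S 1, T 1), …, (S m, T m)` is the list of all resistant pairs, and
`[2, n] = T 0 < T 1 < … < T m` lexicographically. -/
structure IsResistantEnumeration (n k m : ℕ) (S T : ℕ → Finset ℕ) : Prop where
  zero : T 0 = Finset.Icc 2 n
  resistant : ∀ l, 1 ≤ l → l ≤ m → IsResistantPair n k (S l) (T l)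
  complete : ∀ P Q, IsResistantPair n k P Q → ∃ l, 1 ≤ l ∧ l ≤ m ∧ S l = P ∧ T l = Q
  increasing : ∀ i l, i < l → l ≤ m → LexLT (T i) (T l)

/-- The sets obtained from `U` by repeatedly replacing the current set `T` by `T ∪ {2|T|}`. -/
inductive IsNeutralSet (U : Finset ℕ) : Finset ℕ → Prop
  | base : IsNeutralSet U U
  | step (T : Finset ℕ) : IsNeutralSet U T → IsNeutralSet U (insert (2 * T.card) T)

/-- The pair `S, T` is `U`-neutral. -/
def IsNeutralPair (n k : ℕ) (U S T : Finset ℕ) : Prop :=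
  (∃ j, IsStrongPair n k j S T) ∧ IsNeutralSet U T

end LexPairs

namespace LexPairs

/-! ### The lexicographic order -/

/-! A strong pair with top element j is a word on the positions 2, ..., j-1: `true` for elements of
T, `false` for elements of S. Let M be the size of the remaining ground set and a, b the remaining
sizes of the members of the two families. By Pascal's rule the letter `true` contributes C(M-1,a-1)
and lowers b, `false` contributes C(M-1,b-1) and lowers a, and the end of the word contributes both.
So d = a-b is the height of a walk starting at -1, and a+b < M persists. A resistant pair starts
with three up-steps, to height 2, then stays positive and ends at height at least 2; the pair {1,4},
{2,3,4} is the one exception.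

The least resistant word r above w is a prefix of w, and the common letters contribute equally. If w
≠ r, then w continues r by `true` and a tail with no resistant word above it; after cancellation the
count of the tail is compared with C(M,b). At height 1, stopping gives exactly C(M,b); an up-step
leads to the same comparison at height 2; a down-step to height 0 loses strictly, by `pairCount_lt`.
At larger heights such a tail can only descend. Hence equality holds exactly when the tail descends
straight to height 1, then alternates up and down and stops at height 1. These are the words
produced by the steps T' ∪ {2|T'|}. The induction is `exists_least_resistantWord`. -/

theorem lexLE_iff (A B : Finset ℕ) :
    LexLE A B ↔ A = B ∨ ∃ a ∈ A, a ∉ B ∧ ∀ y < a, (y ∈ A ↔ y ∈ B) := by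
  constructor
  · intro h
    by_cases hAB : A = B
    · exact Or.inl hAB
    right
    have hne : (A \ B).Nonempty := by
      rcases h with h | ⟨a, ha, -⟩
      · rw [Finset.sdiff_nonempty]
        exact fun h' => hAB (Finset.Subset.antisymm h' h)
      · exact ⟨a, ha⟩
    have hm := Finset.min'_mem _ hne
    have hm' := Finset.mem_sdiff.1 hm
    refine ⟨_, hm'.1, hm'.2, fun y hy => ⟨fun hyA => ?_, fun hyB => ?_⟩⟩
    · by_contra hyB
      exact absurd (Finset.min'_le _ y (Finset.mem_sdiff.2 ⟨hyA, hyB⟩)) (not_le.2 hy)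
    · by_contra hyA
      rcases h with h | ⟨a, ha, hab⟩
      · exact hyA (h hyB)
      · have h1 := hab y (Finset.mem_sdiff.2 ⟨hyB, hyA⟩)
        have h2 := Finset.min'_le _ a ha
        omega
  · rintro (rfl | ⟨a, haA, haB, h⟩)
    · exact Or.inl (Finset.Subset.refl _)
    · refine Or.inr ⟨a, Finset.mem_sdiff.2 ⟨haA, haB⟩, fun b hb => ?_⟩
      rw [Finset.mem_sdiff] at hb
      rcases lt_trichotomy a b with hab | rfl | hab
      · exact hab
      · exact absurd haA hb.2
      · exact absurd ((h b hab).2 hb.1) hb.2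

theorem LexLE.refl (A : Finset ℕ) : LexLE A A := Or.inl (Finset.Subset.refl _)

theorem LexLE.antisymm {A B : Finset ℕ} (h : LexLE A B) (h' : LexLE B A) : A = B := by
  rw [lexLE_iff] at h h'
  rcases h with h | ⟨a, haA, haB, ha⟩
  · exact h
  rcases h' with h' | ⟨b, hbB, hbA, hb⟩
  · exact h'.symm
  rcases lt_trichotomy a b with hab | rfl | hab
  · exact absurd ((hb a hab).2 haA) haB
  · exact absurd haA hbA
  · exact absurd ((ha b hab).2 hbB) hbA

theorem LexLE.trans {A B C : Finset ℕ} (h : LexLE A B) (h' : LexLE B C) : LexLE A C := by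
  rw [lexLE_iff] at h h' ⊢
  rcases h with rfl | ⟨a, haA, haB, ha⟩
  · exact h'
  rcases h' with rfl | ⟨b, hbB, hbC, hb⟩
  · exact Or.inr ⟨a, haA, haB, ha⟩
  right
  rcases lt_trichotomy a b with hab | rfl | hab
  · exact ⟨a, haA, fun hC => haB ((hb a hab).2 hC),
      fun y hy => (ha y hy).trans (hb y (hy.trans hab))⟩
  · exact absurd hbB haB
  · exact ⟨b, (ha b hab).2 hbB, hbC, fun y hy => (ha y (hy.trans hab)).trans (hb y hy)⟩

theorem lexLE_insert_insert {x : ℕ} {A B : Finset ℕ} (hA : ∀ y ∈ A, x < y) (hB : ∀ y ∈ B, x < y) :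
    LexLE (insert x A) (insert x B) ↔ LexLE A B := by
  have hxA : x ∉ A := fun h => lt_irrefl _ (hA x h)
  have hxB : x ∉ B := fun h => lt_irrefl _ (hB x h)
  unfold LexLE
  rw [Finset.insert_subset_insert_iff hxB, Finset.insert_sdiff_insert, Finset.insert_sdiff_insert,
    Finset.sdiff_insert_of_notMem hxA, Finset.sdiff_insert_of_notMem hxB]

theorem lexLE_insert_left {x : ℕ} (A : Finset ℕ) {B : Finset ℕ} (hB : ∀ y ∈ B, x < y) :
    LexLE (insert x A) B :=
  Or.inr ⟨x, Finset.mem_sdiff.2 ⟨Finset.mem_insert_self _ _, fun h => lt_irrefl _ (hB x h)⟩,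
    fun b hb => hB b (Finset.mem_sdiff.1 hb).1⟩

theorem not_lexLE_insert_right {x : ℕ} {A : Finset ℕ} (B : Finset ℕ) (hA : ∀ y ∈ A, x < y) :
    ¬ LexLE A (insert x B) := by
  have hxA : x ∉ A := fun h => lt_irrefl _ (hA x h)
  rintro (h | ⟨a, ha, h⟩)
  · exact hxA (h (Finset.mem_insert_self _ _))
  · have h1 := h x (Finset.mem_sdiff.2 ⟨Finset.mem_insert_self _ _, hxA⟩)
    have h2 := hA a (Finset.mem_sdiff.1 ha).1
    omega

theorem lexLE_empty (A : Finset ℕ) : LexLE A ∅ := Or.inl (Finset.empty_subset _)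

theorem not_empty_lexLE {B : Finset ℕ} (hB : B.Nonempty) : ¬ LexLE ∅ B := by
  rintro (h | ⟨a, ha, -⟩)
  · exact hB.ne_empty (Finset.subset_empty.1 h)
  · simp at ha

/-! ### Words -/

/-- The set with largest element `x + w.length` whose elements in `[x, x + w.length)` are the
positions of the letter `true` in the word `w`, the first letter having position `x`. -/
def markSet : ℕ → List Bool → Finset ℕ
  | x, [] => {x}
  | x, true :: w => insert x (markSet (x + 1) w)
  | x, false :: w => markSet (x + 1) w

theorem bounds_of_mem_markSet {y : ℕ} (w : List Bool) :
    ∀ {x : ℕ}, y ∈ markSet x w → x ≤ y ∧ y ≤ x + w.length := by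
  induction w with
  | nil => intro x h; simp [markSet] at h; simp [h]
  | cons c w ih =>
    intro x h
    cases c
    · have := ih (x := x + 1) h
      simp only [List.length_cons]; omega
    · simp only [markSet, Finset.mem_insert] at h
      simp only [List.length_cons]
      rcases h with rfl | h
      · omega
      · have := ih (x := x + 1) h; omega

theorem lt_of_mem_markSet_succ {x : ℕ} (w : List Bool) : ∀ y ∈ markSet (x + 1) w, x < y :=
  fun _ hy => (bounds_of_mem_markSet w hy).1

theorem notMem_markSet_succ (x : ℕ) (w : List Bool) : x ∉ markSet (x + 1) w :=
  fun h => lt_irrefl _ (lt_of_mem_markSet_succ w x h)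

theorem add_length_mem_markSet (w : List Bool) : ∀ x : ℕ, x + w.length ∈ markSet x w := by
  induction w with
  | nil => intro x; simp [markSet]
  | cons c w ih =>
    intro x
    have := ih (x + 1)
    rw [show x + 1 + w.length = x + (c :: w).length by simp; omega] at this
    cases c
    · exact this
    · exact Finset.mem_insert_of_mem this

theorem card_markSet (w : List Bool) : ∀ x : ℕ, (markSet x w).card = w.count true + 1 := by
  induction w with
  | nil => intro x; simp [markSet]
  | cons c w ih =>
    intro x
    cases c
    · simpa [markSet] using ih (x + 1)
    · rw [markSet, Finset.card_insert_of_notMem (notMem_markSet_succ x w), ih]; simp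

theorem markSet_inter_map_not (w : List Bool) :
    ∀ x : ℕ, markSet x (w.map not) ∩ markSet x w = {x + w.length} := by
  induction w with
  | nil => intro x; simp [markSet]
  | cons c w ih =>
    intro x
    have := ih (x + 1)
    rw [show x + 1 + w.length = x + (c :: w).length by simp; omega] at this
    cases c
    · simpa [markSet, Finset.insert_inter_of_notMem (notMem_markSet_succ x w)] using this
    · simpa [markSet, Finset.inter_insert_of_notMem (notMem_markSet_succ x (w.map not))] using this

theorem markSet_union_map_not (w : List Bool) :
    ∀ x : ℕ, markSet x (w.map not) ∪ markSet x w = Finset.Icc x (x + w.length) := by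
  induction w with
  | nil => intro x; simp [markSet]
  | cons c w ih =>
    intro x
    have h : Finset.Icc x (x + (c :: w).length) =
        insert x (markSet (x + 1) (w.map not) ∪ markSet (x + 1) w) := by
      rw [ih]; ext y; simp; omega
    rw [h]
    cases c
    · simp [markSet]
    · simp [markSet]

theorem exists_markSet_eq (m : ℕ) : ∀ (x : ℕ) (T : Finset ℕ), T ⊆ Finset.Icc x (x + m) →
    x + m ∈ T → ∃ w : List Bool, w.length = m ∧ T = markSet x w := by
  induction m with
  | zero =>
    intro x T hT hx
    refine ⟨[], rfl, Finset.Subset.antisymm ?_ ?_⟩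
    · simpa [markSet] using hT
    · simpa [markSet] using hx
  | succ m ih =>
    intro x T hT hx
    obtain ⟨w, hw, h⟩ := ih (x + 1) (T.erase x) (by
        intro y hy
        rw [Finset.mem_erase] at hy
        have := Finset.mem_Icc.1 (hT hy.2)
        rw [Finset.mem_Icc]; omega) (by
        rw [Finset.mem_erase]
        exact ⟨by omega, by rwa [show x + 1 + m = x + (m + 1) by omega]⟩)
    by_cases hxT : x ∈ T
    · exact ⟨true :: w, by simp [hw], by rw [markSet, ← h, Finset.insert_erase hxT]⟩
    · exact ⟨false :: w, by simp [hw], by rw [markSet, ← h, Finset.erase_eq_of_notMem hxT]⟩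

/-- The lexicographic order of the sets `markSet x w`, in terms of words. -/
def WordLE : List Bool → List Bool → Prop
  | [], [] => True
  | [], true :: _ => False
  | [], false :: _ => True
  | true :: _, [] => True
  | false :: _, [] => False
  | true :: w, true :: u => WordLE w u
  | false :: w, false :: u => WordLE w u
  | true :: _, false :: _ => True
  | false :: _, true :: _ => False

/-- The end of a word ranks between `true` and `false`: the top element does belong to the set, as
after `true`, but supersets come earlier in the order. -/
theorem lexLE_markSet_iff (w : List Bool) :
    ∀ (x : ℕ) (u : List Bool), LexLE (markSet x w) (markSet x u) ↔ WordLE w u := by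
  induction w with
  | nil =>
    intro x u
    match u with
    | [] => simp [WordLE, LexLE.refl]
    | true :: u =>
      simp only [WordLE, iff_false]
      rw [markSet, markSet, ← insert_empty_eq, lexLE_insert_insert (by simp)
        (lt_of_mem_markSet_succ u)]
      exact not_empty_lexLE ⟨_, add_length_mem_markSet u _⟩
    | false :: u =>
      simp only [WordLE, iff_true]
      rw [markSet, markSet, ← insert_empty_eq]
      exact lexLE_insert_left _ (lt_of_mem_markSet_succ u)
  | cons c w ih =>
    intro x u
    match c, u with
    | true, [] =>
      simp only [WordLE, iff_true]
      rw [markSet, markSet, ← insert_empty_eq, lexLE_insert_insert (lt_of_mem_markSet_succ w)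
        (by simp)]
      exact lexLE_empty _
    | false, [] =>
      simp only [WordLE, iff_false]
      rw [markSet, markSet, ← insert_empty_eq]
      exact not_lexLE_insert_right _ (lt_of_mem_markSet_succ w)
    | true, true :: u =>
      rw [markSet, markSet, lexLE_insert_insert (lt_of_mem_markSet_succ w)
        (lt_of_mem_markSet_succ u), ih, WordLE]
    | false, false :: u => rw [markSet, markSet, ih, WordLE]
    | true, false :: u =>
      simp only [WordLE, iff_true]
      exact lexLE_insert_left _ (lt_of_mem_markSet_succ u)
    | false, true :: u =>
      simp only [WordLE, iff_false]
      exact not_lexLE_insert_right _ (lt_of_mem_markSet_succ w)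

theorem markSet_injective (x : ℕ) : Function.Injective (markSet x) := by
  have key : ∀ w u : List Bool, WordLE w u → WordLE u w → w = u := by
    intro w
    induction w with
    | nil => intro u; rcases u with _ | ⟨_ | _, u⟩ <;> simp [WordLE]
    | cons c w ih =>
      intro u
      rcases c with _ | _ <;> rcases u with _ | ⟨_ | _, u⟩ <;> simp [WordLE]
      · exact ih u
      · exact ih u
  intro w u h
  have h' : markSet x w = markSet x u := h
  exact key w u ((lexLE_markSet_iff w x u).1 (h' ▸ LexLE.refl _))
    ((lexLE_markSet_iff u x w).1 (h' ▸ LexLE.refl _))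

/-! ### Sizes of the lexicographic families -/

/-- The number of `a`-element subsets of an `M`-element interval `[x, x + M)` that are
lexicographically at most `markSet x w`. -/
def lexCount : ℕ → ℕ → List Bool → ℕ
  | M, a, [] => (M - 1).choose (a - 1)
  | M, a, true :: w => lexCount (M - 1) (a - 1) w
  | M, a, false :: w => (M - 1).choose (a - 1) + lexCount (M - 1) a w

/-- Sets avoiding x come after every set containing it, so only those through x count, and x can be
deleted from both sides. -/
theorem card_filter_lexLE_insert {x n a : ℕ} (hx : x ≤ n) {T : Finset ℕ} (hT : ∀ y ∈ T, x < y) :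
    ((Finset.powersetCard (a + 1) (Finset.Icc x n)).filter (fun A => LexLE A (insert x T))).card =
      ((Finset.powersetCard a (Finset.Icc (x + 1) n)).filter (fun A => LexLE A T)).card := by
  have hI : Finset.Icc x n = insert x (Finset.Icc (x + 1) n) := by
    ext y; simp; omega
  have hgt : ∀ (c : ℕ), ∀ A ∈ Finset.powersetCard c (Finset.Icc (x + 1) n), ∀ y ∈ A, x < y := by
    intro c A hA y hy
    have := Finset.mem_Icc.1 ((Finset.mem_powersetCard.1 hA).1 hy)
    omega
  rw [hI, Finset.powersetCard_succ_insert (by simp), Finset.filter_union, Finset.filter_eq_empty_iff.2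
    (fun {A} hA => not_lexLE_insert_right T (hgt _ A hA)), Finset.empty_union, Finset.filter_image,
    Finset.card_image_of_injOn]
  · congr 1
    apply Finset.filter_congr
    intro A hA
    exact lexLE_insert_insert (hgt _ A hA) hT
  · intro A hA B hB hAB
    have hA' := hgt _ A (Finset.mem_filter.1 hA).1
    have hB' := hgt _ B (Finset.mem_filter.1 hB).1
    have h : (insert x A).erase x = (insert x B).erase x := congrArg (fun C => Finset.erase C x) hAB
    rwa [Finset.erase_insert (fun h => lt_irrefl _ (hA' x h)),
      Finset.erase_insert (fun h => lt_irrefl _ (hB' x h))] at h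

theorem card_filter_lexLE_of_lt {x n a : ℕ} (hx : x ≤ n) {T : Finset ℕ} (hT : ∀ y ∈ T, x < y) :
    ((Finset.powersetCard (a + 1) (Finset.Icc x n)).filter (fun A => LexLE A T)).card =
      (n - x).choose a +
      ((Finset.powersetCard (a + 1) (Finset.Icc (x + 1) n)).filter (fun A => LexLE A T)).card := by
  have hI : Finset.Icc x n = insert x (Finset.Icc (x + 1) n) := by
    ext y; simp; omega
  have hnot : ∀ (c : ℕ), ∀ A ∈ Finset.powersetCard c (Finset.Icc (x + 1) n), x ∉ A := by
    intro c A hA hy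
    have := Finset.mem_Icc.1 ((Finset.mem_powersetCard.1 hA).1 hy)
    omega
  rw [hI, Finset.powersetCard_succ_insert (by simp), Finset.filter_union, Finset.card_union_of_disjoint,
    add_comm]
  · congr 1
    rw [Finset.filter_true_of_mem, Finset.card_image_of_injOn, Finset.card_powersetCard]
    · simp
    · intro A hA B hB hAB
      have h : (insert x A).erase x = (insert x B).erase x :=
        congrArg (fun C => Finset.erase C x) hAB
      rwa [Finset.erase_insert (hnot _ A hA), Finset.erase_insert (hnot _ B hB)] at h
    · intro A hA
      obtain ⟨B, -, rfl⟩ := Finset.mem_image.1 hA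
      exact lexLE_insert_left _ hT
  · apply Finset.disjoint_filter_filter
    rw [Finset.disjoint_left]
    intro A hA hA'
    obtain ⟨B, -, rfl⟩ := Finset.mem_image.1 hA'
    exact hnot _ _ hA (Finset.mem_insert_self _ _)

/-- The bound on a keeps the truncated subtractions in `lexCount` honest. -/
theorem card_filter_lexLE_markSet (n : ℕ) (w : List Bool) :
    ∀ (x a : ℕ), x + w.length ≤ n → w.count true + 1 ≤ a →
      ((Finset.powersetCard a (Finset.Icc x n)).filter (fun A => LexLE A (markSet x w))).card =
        lexCount (n + 1 - x) a w := by
  induction w with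
  | nil =>
    intro x a hx ha
    obtain ⟨a, rfl⟩ : ∃ c, a = c + 1 := ⟨a - 1, by omega⟩
    simp only [List.length_nil, add_zero] at hx
    rw [markSet, ← insert_empty_eq, card_filter_lexLE_insert hx (by simp),
      Finset.filter_true_of_mem (fun A _ => lexLE_empty A), Finset.card_powersetCard, lexCount]
    simp only [Nat.card_Icc, Nat.add_sub_cancel]
    congr 1
  | cons c w ih =>
    intro x a hx ha
    obtain ⟨a, rfl⟩ : ∃ c, a = c + 1 := ⟨a - 1, by omega⟩
    simp only [List.length_cons] at hx
    cases c
    · simp only [List.count_cons, Bool.false_beq, Bool.not_true] at ha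
      rw [markSet, card_filter_lexLE_of_lt (by omega) (lt_of_mem_markSet_succ w),
        ih (x + 1) (a + 1) (by omega) (by simpa using ha), lexCount]
      congr 2 ; omega
    · simp only [List.count_cons_self] at ha
      rw [markSet, card_filter_lexLE_insert (by omega) (lt_of_mem_markSet_succ w),
        ih (x + 1) a (by omega) (by omega), lexCount]
      congr 1


/-! ### The sum of the two sizes -/

/-- Since i + j < N, the index j is closer to N/2 than i. Past the middle, j is reflected to N - j,
which still exceeds i. -/
theorem choose_lt_choose_of_add_lt {N i j : ℕ} (hij : i < j) (h : i + j < N) :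
    N.choose i < N.choose j := by
  have step : ∀ i, 2 * i + 1 < N → N.choose i < N.choose (i + 1) := by
    intro i hi
    have h1 := Nat.choose_succ_right_eq N i
    have h2 : 0 < N.choose i := Nat.choose_pos (by omega)
    by_contra hcon
    rw [not_lt] at hcon
    have h3 : N.choose (i + 1) * (i + 1) ≤ N.choose i * (i + 1) := Nat.mul_le_mul_right _ hcon
    have h4 : N.choose i * (i + 1) < N.choose i * (N - i) :=
      Nat.mul_lt_mul_of_pos_left (by omega) h2
    omega
  have low : ∀ j, i < j → 2 * j ≤ N → N.choose i < N.choose j := by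
    intro j hij
    induction j, hij using Nat.le_induction with
    | base => intro hj; exact step i (by omega)
    | succ j hj ih => intro hN; exact (ih (by omega)).trans (step j (by omega))
  rcases le_total (2 * j) N with hj | hj
  · exact low j hij hj
  · by_cases hjN : j ≤ N
    · rw [← Nat.choose_symm hjN]
      exact low (N - j) (by omega) (by omega)
    · omega

/-- The size of `𝓛(S, a)` plus that of `𝓛(T, b)` in an `M`-element interval, where `T` is given by
the word `w` and `S` by the complementary word. -/
def pairCount (M a b : ℕ) (w : List Bool) : ℕ := lexCount M a (w.map not) + lexCount M b w

theorem pairCount_nil (M a b : ℕ) :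
    pairCount M a b [] = (M - 1).choose (a - 1) + (M - 1).choose (b - 1) := rfl

theorem pairCount_true (M a b : ℕ) (w : List Bool) :
    pairCount M a b (true :: w) = (M - 1).choose (a - 1) + pairCount (M - 1) a (b - 1) w := by
  simp [pairCount, lexCount]; ring

theorem pairCount_false (M a b : ℕ) (w : List Bool) :
    pairCount M a b (false :: w) = (M - 1).choose (b - 1) + pairCount (M - 1) (a - 1) b w := by
  simp [pairCount, lexCount]; ring

/-- Split the bound by Pascal's rule: one part bounds the rest of the word by induction, and the
other equals the current contribution or exceeds it by `choose_lt_choose_of_add_lt`. The case a = b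
is the walk at height 0. -/
theorem pairCount_lt (w : List Bool) : ∀ M a b : ℕ, w.count true + 1 ≤ b → w.count false + 1 ≤ a →
    a + b < M → pairCount M a b w < M.choose (max a b) := by
  induction w with
  | nil =>
    intro M a b hb ha hM
    obtain ⟨M, rfl⟩ : ∃ c, M = c + 1 := ⟨M - 1, by omega⟩
    obtain ⟨a, rfl⟩ : ∃ c, a = c + 1 := ⟨a - 1, by omega⟩
    obtain ⟨b, rfl⟩ : ∃ c, b = c + 1 := ⟨b - 1, by omega⟩
    simp only [pairCount_nil, Nat.add_sub_cancel]
    rcases le_total a b with hab | hab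
    · rw [max_eq_right (by omega), Nat.choose_succ_succ']
      have := choose_lt_choose_of_add_lt (N := M) (i := a) (j := b + 1) (by omega) (by omega)
      omega
    · rw [max_eq_left (by omega), Nat.choose_succ_succ']
      have := choose_lt_choose_of_add_lt (N := M) (i := b) (j := a + 1) (by omega) (by omega)
      omega
  | cons c w ih =>
    intro M a b hb ha hM
    obtain ⟨M, rfl⟩ : ∃ c, M = c + 1 := ⟨M - 1, by omega⟩
    obtain ⟨a, rfl⟩ : ∃ c, a = c + 1 := ⟨a - 1, by omega⟩
    obtain ⟨b, rfl⟩ : ∃ c, b = c + 1 := ⟨b - 1, by omega⟩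
    cases c
    · simp at ha hb
      simp only [pairCount_false, Nat.add_sub_cancel]
      have h := ih M a (b + 1) (by omega) (by omega) (by omega)
      rcases le_or_gt a b with hab | hab
      · rw [max_eq_right (by omega), Nat.choose_succ_succ']
        rw [max_eq_right (by omega)] at h
        omega
      · rw [max_eq_left (by omega), Nat.choose_succ_succ']
        rw [max_eq_left (by omega)] at h
        have := choose_lt_choose_of_add_lt (N := M) (i := b) (j := a + 1) (by omega) (by omega)
        omega
    · simp at ha hb
      simp only [pairCount_true, Nat.add_sub_cancel]
      have h := ih M (a + 1) b (by omega) (by omega) (by omega)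
      rcases le_or_gt b a with hab | hab
      · rw [max_eq_left (by omega), Nat.choose_succ_succ']
        rw [max_eq_left (by omega)] at h
        omega
      · rw [max_eq_right (by omega), Nat.choose_succ_succ']
        rw [max_eq_right (by omega)] at h
        have := choose_lt_choose_of_add_lt (N := M) (i := a) (j := b + 1) (by omega) (by omega)
        omega

/-! ### Resistant and neutral words -/

/-- Reading `w` from height `d`, where `true` is an up-step and `false` a down-step, the height
stays positive, and it is at least two at the end. -/
def ResistantWord : ℕ → List Bool → Prop
  | d, [] => 2 ≤ d
  | d, true :: w => ResistantWord (d + 1) w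
  | d, false :: w => 2 ≤ d ∧ ResistantWord (d - 1) w

/-- The word `true false true false …` with `i` occurrences of `true`. -/
def zigzag : ℕ → List Bool
  | 0 => []
  | i + 1 => true :: false :: zigzag i

/-- `w` is neutral with respect to a word `r` read from height `d`. -/
def NeutralWord (d : ℕ) (r w : List Bool) : Prop :=
  w = r ∨ ∃ e i, d + r.count true = r.count false + e ∧
    w = r ++ true :: (List.replicate e false ++ zigzag i)

theorem neutralWord_nil_true (d : ℕ) (w : List Bool) :
    NeutralWord d [] (true :: w) ↔ ∃ i, w = List.replicate d false ++ zigzag i := by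
  simp [NeutralWord]

theorem neutralWord_true_true (d : ℕ) (r w : List Bool) :
    NeutralWord d (true :: r) (true :: w) ↔ NeutralWord (d + 1) r w := by
  simp only [NeutralWord, List.cons.injEq, true_and, List.count_cons_self, List.cons_append]
  have h : ∀ e, (d + (r.count true + 1) = (true :: r).count false + e) ↔
      (d + 1 + r.count true = r.count false + e) := by
    intro e; simp; omega
  simp only [h]

theorem neutralWord_false_false (d : ℕ) (r w : List Bool) :
    NeutralWord (d + 1) (false :: r) (false :: w) ↔ NeutralWord d r w := by
  simp only [NeutralWord, List.cons.injEq, true_and, List.count_cons_self, List.cons_append]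
  have h : ∀ e, (d + 1 + (false :: r).count true = r.count false + 1 + e) ↔
      (d + r.count true = r.count false + e) := by
    intro e; simp; omega
  simp only [h]

/-- The first alternative is what makes the induction close: C(M,b) is the threshold left over when
an earlier stop at height at least 2 is compared with going up. The bound on `r.count true` later
ensures that r respects the size limit k. -/
theorem exists_least_resistantWord (w : List Bool) : ∀ d b M : ℕ, 1 ≤ d → w.count true + 1 ≤ b →
    w.count false + 1 ≤ b + d → b + d + b < M →
    ((∀ u, ResistantWord d u → ¬ WordLE w u) ∧ pairCount M (b + d) b w ≤ M.choose b ∧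
      (pairCount M (b + d) b w = M.choose b ↔
        ∃ i, w = List.replicate (d - 1) false ++ zigzag i)) ∨
    ∃ r, ResistantWord d r ∧ r.count true ≤ w.count true ∧ WordLE w r ∧
      (∀ u, ResistantWord d u → WordLE w u → WordLE r u) ∧
      (pairCount M (b + d) b w = pairCount M (b + d) b r ↔ NeutralWord d r w) := by
  induction w with
  | nil =>
    intro d b M hd hb ha hM
    obtain ⟨M, rfl⟩ : ∃ c, M = c + 1 := ⟨M - 1, by omega⟩
    obtain ⟨b, rfl⟩ : ∃ c, b = c + 1 := ⟨b - 1, by omega⟩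
    rcases Nat.lt_or_ge 1 d with hd2 | hd1
    · right
      exact ⟨[], hd2, le_rfl, trivial, fun u _ h => h, by simp [NeutralWord]⟩
    · left
      obtain rfl : d = 1 := by omega
      have hG : pairCount (M + 1) (b + 1 + 1) (b + 1) [] = (M + 1).choose (b + 1) := by
        simp only [pairCount_nil, Nat.add_sub_cancel, Nat.choose_succ_succ']; omega
      refine ⟨?_, hG.le, ?_⟩
      · intro u
        rcases u with _ | ⟨_ | _, u⟩ <;> simp [WordLE, ResistantWord]
      · simp only [hG, true_iff]
        exact ⟨0, rfl⟩
  | cons c w ih =>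
    intro d b M hd hb ha hM
    obtain ⟨M, rfl⟩ : ∃ c, M = c + 1 := ⟨M - 1, by omega⟩
    obtain ⟨b, rfl⟩ : ∃ c, b = c + 1 := ⟨b - 1, by omega⟩
    cases c
    · simp at ha hb
      obtain ⟨d, rfl⟩ : ∃ c, d = c + 1 := ⟨d - 1, by omega⟩
      have hG : ∀ v, pairCount (M + 1) (b + 1 + (d + 1)) (b + 1) (false :: v) =
          M.choose b + pairCount M (b + 1 + d) (b + 1) v := by
        intro v; rw [pairCount_false]; rfl
      -- The height is now d + 1, so d = 0 is a down-step from height 1 to 0, which no resistant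
      -- word makes.
      rcases Nat.eq_zero_or_pos d with rfl | hd0
      · left
        have hlt := pairCount_lt w M (b + 1) (b + 1) (by omega) (by omega) (by omega)
        rw [max_self] at hlt
        have hlt' : pairCount (M + 1) (b + 1 + (0 + 1)) (b + 1) (false :: w) <
            (M + 1).choose (b + 1) := by
          rw [hG, Nat.choose_succ_succ', add_zero]; exact Nat.add_lt_add_left hlt _
        refine ⟨?_, hlt'.le, ?_⟩
        · intro u
          rcases u with _ | ⟨_ | _, u⟩ <;> simp [WordLE, ResistantWord]
        · refine ⟨fun h => absurd h hlt'.ne, ?_⟩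
          rintro ⟨i, hi⟩
          cases i <;> simp [zigzag] at hi
      · rcases ih d (b + 1) M hd0 (by omega) (by omega) (by omega) with
          ⟨h1, h2, h3⟩ | ⟨r, h1, h2, h3, h4, h5⟩
        · left
          rw [hG, Nat.choose_succ_succ', Nat.add_left_cancel_iff, h3]
          refine ⟨?_, Nat.add_le_add_left h2 _, ?_⟩
          · intro u
            rcases u with _ | ⟨_ | _, u⟩
            · simp [WordLE]
            · simp only [ResistantWord, WordLE, Nat.add_sub_cancel]
              exact fun h => h1 u h.2
            · simp [WordLE]
          · obtain ⟨d, rfl⟩ : ∃ c, d = c + 1 := ⟨d - 1, by omega⟩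
            simp [List.replicate_succ]
        · right
          refine ⟨false :: r, ⟨by omega, h1⟩, by simpa using h2, h3, ?_, ?_⟩
          · intro u
            rcases u with _ | ⟨_ | _, u⟩
            · simp [WordLE]
            · simp only [ResistantWord, WordLE, Nat.add_sub_cancel]
              exact fun h => h4 u h.2
            · simp [WordLE]
          · rw [hG, hG, Nat.add_left_cancel_iff, h5, neutralWord_false_false]
    · simp at ha hb
      have hG : ∀ v, pairCount (M + 1) (b + 1 + d) (b + 1) (true :: v) =
          M.choose (b + d) + pairCount M (b + (d + 1)) b v := by
        intro v
        rw [pairCount_true, show b + 1 + d = b + (d + 1) by omega]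
        rfl
      rcases ih (d + 1) b M (by omega) (by omega) (by omega) (by omega) with
          ⟨h1, h2, h3⟩ | ⟨r, h1, h2, h3, h4, h5⟩
      -- Nothing resistant lies above the tail. From height at least 2 the empty word is therefore
      -- the least resistant one; from height 1 the first alternative persists.
      · rcases Nat.lt_or_ge 1 d with hd2 | hd1
        · right
          refine ⟨[], hd2, by simp, trivial, ?_, ?_⟩
          · intro u
            rcases u with _ | ⟨_ | _, u⟩
            · simp [WordLE]
            · simp [WordLE]
            · simp only [ResistantWord, WordLE]
              exact fun h h' => h1 u h h'
          · have hE : pairCount (M + 1) (b + 1 + d) (b + 1) [] = M.choose (b + d) + M.choose b := by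
              rw [pairCount_nil, show b + 1 + d = b + d + 1 by omega]; rfl
            rw [hG, hE, Nat.add_left_cancel_iff, h3, neutralWord_nil_true, Nat.add_sub_cancel]
        · left
          obtain rfl : d = 1 := by omega
          rw [hG, Nat.choose_succ_succ', Nat.add_comm (M.choose b),
            Nat.add_left_cancel_iff, h3]
          refine ⟨?_, Nat.add_le_add_left h2 _, ?_⟩
          · intro u
            rcases u with _ | ⟨_ | _, u⟩
            · simp [ResistantWord]
            · simp [ResistantWord]
            · simp only [ResistantWord, WordLE]
              exact h1 u
          · constructor
            · rintro ⟨i, rfl⟩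
              exact ⟨i + 1, rfl⟩
            · rintro ⟨i, hi⟩
              cases i with
              | zero => simp [zigzag] at hi
              | succ i =>
                refine ⟨i, ?_⟩
                simpa [zigzag] using hi
      · right
        refine ⟨true :: r, h1, by simpa using h2, h3, ?_, ?_⟩
        · intro u
          rcases u with _ | ⟨_ | _, u⟩
          · simp [WordLE]
          · simp [WordLE]
          · simp only [ResistantWord, WordLE]
            exact h4 u
        · rw [hG, hG, Nat.add_left_cancel_iff, h5, neutralWord_true_true]


/-! ### Strong pairs and words -/

theorem length_eq_count (w : List Bool) : w.length = w.count true + w.count false := by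
  induction w with
  | nil => rfl
  | cons c w ih =>
    rw [List.length_cons, ih]
    cases c
    · rw [List.count_cons_self, List.count_cons_of_ne (by decide)]; omega
    · rw [List.count_cons_self, List.count_cons_of_ne (by decide)]; omega

theorem count_true_map_not (w : List Bool) : (w.map not).count true = w.count false := by
  induction w with
  | nil => rfl
  | cons c w ih => cases c <;> simp [ih]

theorem IsStrongPair.exists_word {n k j : ℕ} {S T : Finset ℕ} (h : IsStrongPair n k j S T) :
    ∃ w : List Bool, 2 + w.length = j ∧ T = markSet 2 w ∧ S = insert 1 (markSet 2 (w.map not)) := by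
  have hj : j ∈ S ∩ T := by rw [h.inter_eq]; exact Finset.mem_singleton_self _
  have hj2 := Finset.mem_Icc.1 (h.subset_right (Finset.mem_inter.1 hj).2)
  obtain ⟨w, hw, hT⟩ := exists_markSet_eq (j - 2) 2 T (by
    intro y hy
    have h1 := Finset.mem_Icc.1 (h.subset_right hy)
    have h2 : y ∈ Finset.Icc 1 j := by rw [← h.union_eq]; exact Finset.mem_union_right _ hy
    rw [Finset.mem_Icc] at h2 ⊢
    omega) (by rw [Nat.add_sub_cancel' hj2.1]; exact (Finset.mem_inter.1 hj).2)
  have hlen : 2 + w.length = j := by omega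
  refine ⟨w, hlen, hT, ?_⟩
  ext y
  have h1 := Finset.ext_iff.1 h.inter_eq y
  have h2 := Finset.ext_iff.1 h.union_eq y
  have h3 := Finset.ext_iff.1 (markSet_inter_map_not w 2) y
  have h4 := Finset.ext_iff.1 (markSet_union_map_not w 2) y
  rw [← hT, hlen] at h3 h4
  have h5 : y ∈ T → 2 ≤ y := fun hy => (Finset.mem_Icc.1 (h.subset_right hy)).1
  simp only [Finset.mem_inter, Finset.mem_union, Finset.mem_Icc, Finset.mem_singleton,
    Finset.mem_insert] at h1 h2 h3 h4 ⊢
  by_cases hT : y ∈ T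
  · have := h5 hT
    simp only [hT, and_true] at h1 h3
    rw [h1, h3]
    omega
  · simp only [hT, or_false] at h2 h4
    rw [h2, h4]
    omega

theorem isStrongPair_markSet {n k : ℕ} (hn : 2 * k < n) {w : List Bool} (hT : w.count true + 1 ≤ k)
    (hS : w.count false + 2 ≤ k) :
    IsStrongPair n k (2 + w.length) (insert 1 (markSet 2 (w.map not))) (markSet 2 w) := by
  have hlen := length_eq_count w
  have hb : ∀ y ∈ markSet 2 (w.map not), 2 ≤ y ∧ y ≤ 2 + w.length := by
    intro y hy
    simpa using bounds_of_mem_markSet _ hy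
  have hb' : ∀ y ∈ markSet 2 w, 2 ≤ y ∧ y ≤ 2 + w.length := fun y hy => bounds_of_mem_markSet _ hy
  have h1 : 1 ∉ markSet 2 w := notMem_markSet_succ 1 w
  refine ⟨?_, ?_, ?_, ?_, ?_, ?_⟩
  · intro y hy
    rw [Finset.mem_Icc]
    rcases Finset.mem_insert.1 hy with rfl | hy
    · omega
    · have := hb y hy; omega
  · intro y hy
    rw [Finset.mem_Icc]
    have := hb' y hy; omega
  · rw [Finset.insert_inter_of_notMem h1, markSet_inter_map_not]
  · rw [Finset.insert_union, markSet_union_map_not]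
    ext y; simp; omega
  · rw [Finset.card_insert_of_notMem (notMem_markSet_succ 1 _), card_markSet, count_true_map_not]
    omega
  · rwa [card_markSet]

theorem IsStrongPair.count_le {n k j : ℕ} {w : List Bool}
    (h : IsStrongPair n k j (insert 1 (markSet 2 (w.map not))) (markSet 2 w)) :
    w.count true + 1 ≤ k ∧ w.count false + 2 ≤ k := by
  have h1 := h.card_left
  have h2 := h.card_right
  rw [Finset.card_insert_of_notMem (notMem_markSet_succ 1 _), card_markSet,
    count_true_map_not] at h1
  rw [card_markSet] at h2
  exact ⟨h2, h1⟩

theorem card_lexFamily_add {n k : ℕ} (hn : 2 * k < n) {w : List Bool} (hT : w.count true + 1 ≤ k)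
    (hS : w.count false + 2 ≤ k) :
    (lexFamily n (insert 1 (markSet 2 (w.map not))) (k - 1)).card +
      (lexFamily n (markSet 2 w) k).card = pairCount (n - 1) (k - 1) k w := by
  have h := isStrongPair_markSet hn hT hS
  have hlen := length_eq_count w
  have hS' : insert 1 (markSet 2 (w.map not)) ∩ Finset.Icc 2 n = markSet 2 (w.map not) := by
    ext y
    have := bounds_of_mem_markSet (y := y) (w.map not) (x := 2)
    simp only [List.length_map] at this
    simp only [Finset.mem_inter, Finset.mem_insert, Finset.mem_Icc]
    constructor
    · rintro ⟨rfl | h, h'⟩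
      · omega
      · exact h
    · intro hy
      have := this hy
      exact ⟨Or.inr hy, by omega⟩
  rw [lexFamily, lexFamily, hS', Finset.inter_eq_left.2 h.subset_right,
    card_filter_lexLE_markSet n (w.map not) 2 (k - 1) (by simp; omega)
      (by rw [count_true_map_not]; omega),
    card_filter_lexLE_markSet n w 2 k (by omega) hT]
  rfl

/-! ### Resistant pairs and words -/

theorem ResistantWord.count_le {r : List Bool} : ∀ {d : ℕ}, ResistantWord d r →
    r.count false + 2 ≤ d + r.count true := by
  induction r with
  | nil => intro d h; simpa [ResistantWord] using h
  | cons c r ih =>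
    intro d h
    cases c
    · have := ih h.2
      have := h.1
      simp; omega
    · have := ih (d := d + 1) h
      simp; omega

/-- The top element lies in both sets, so the last inequality includes one extra down-step; this is
why the walk must end at height at least 2. -/
theorem resistantWord_iff (r : List Bool) : ∀ x d : ℕ, ResistantWord d r ↔
    ∀ i, x ≤ i → i ≤ x + r.length →
      (Finset.Icc x i ∩ markSet x (r.map not)).card <
        (Finset.Icc x i \ markSet x (r.map not)).card + d := by
  have hI : ∀ x i : ℕ, x ≤ i → Finset.Icc x i = insert x (Finset.Icc (x + 1) i) := by
    intro x i hi; ext y; simp; omega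
  have hE : ∀ x : ℕ, Finset.Icc (x + 1) x = ∅ := by intro x; simp
  induction r with
  | nil =>
    intro x d
    simp only [ResistantWord, List.length_nil, List.map_nil, markSet, add_zero]
    constructor
    · intro h i h1 h2
      obtain rfl : i = x := by omega
      simp; omega
    · intro h
      have := h x le_rfl le_rfl
      simp at this; omega
  | cons c r ih =>
    intro x d
    have hx := notMem_markSet_succ x (r.map not)
    have hx' : ∀ i, x ∉ Finset.Icc (x + 1) i := by simp
    cases c
    · have key : ∀ i, x ≤ i → (Finset.Icc x i ∩ markSet x ((false :: r).map not)).card =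
          (Finset.Icc (x + 1) i ∩ markSet (x + 1) (r.map not)).card + 1 ∧
          (Finset.Icc x i \ markSet x ((false :: r).map not)).card =
          (Finset.Icc (x + 1) i \ markSet (x + 1) (r.map not)).card := by
        intro i hi
        rw [hI x i hi, List.map_cons, Bool.not_false, markSet, ← Finset.insert_inter_distrib,
          Finset.card_insert_of_notMem (by simp), Finset.insert_sdiff_insert,
          Finset.sdiff_insert_of_notMem (hx' i)]
        exact ⟨rfl, rfl⟩
      simp only [ResistantWord]
      rw [ih (x + 1) (d - 1)]
      constructor
      · rintro ⟨hd, h⟩ i hi hi'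
        rw [(key i hi).1, (key i hi).2]
        rcases Nat.eq_or_lt_of_le hi with rfl | hlt
        · rw [hE]; simp; omega
        · have := h i hlt (by simp at hi'; omega)
          omega
      · intro h
        have hd : 2 ≤ d := by
          have := h x le_rfl (by omega)
          rw [(key x le_rfl).1, (key x le_rfl).2, hE] at this
          simp at this; omega
        refine ⟨hd, fun i hi hi' => ?_⟩
        have := h i (by omega) (by simp; omega)
        rw [(key i (by omega)).1, (key i (by omega)).2] at this
        omega
    · have key : ∀ i, x ≤ i → (Finset.Icc x i ∩ markSet x ((true :: r).map not)).card =
          (Finset.Icc (x + 1) i ∩ markSet (x + 1) (r.map not)).card ∧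
          (Finset.Icc x i \ markSet x ((true :: r).map not)).card =
          (Finset.Icc (x + 1) i \ markSet (x + 1) (r.map not)).card + 1 := by
        intro i hi
        rw [hI x i hi, List.map_cons, Bool.not_true, markSet, Finset.insert_inter_of_notMem hx,
          Finset.insert_sdiff_of_notMem _ hx, Finset.card_insert_of_notMem (by simp)]
        exact ⟨rfl, rfl⟩
      simp only [ResistantWord]
      rw [ih (x + 1) (d + 1)]
      constructor
      · intro h i hi hi'
        rw [(key i hi).1, (key i hi).2]
        rcases Nat.eq_or_lt_of_le hi with rfl | hlt
        · rw [hE]; simp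
        · have := h i hlt (by simp at hi'; omega)
          omega
      · intro h i hi hi'
        have := h i (by omega) (by simp; omega)
        rw [(key i (by omega)).1, (key i (by omega)).2] at this
        omega

/-- The words of the resistant pairs. -/
def IsResistantStart (u : List Bool) : Prop :=
  u = [true, true] ∨ ∃ r, u = true :: true :: true :: r ∧ ResistantWord 2 r

theorem card_inter_insert_one {i : ℕ} (hi : 4 ≤ i) {U : Finset ℕ} (hU : ∀ y ∈ U, 5 ≤ y) :
    (Finset.Icc 1 i ∩ insert 1 U).card = (Finset.Icc 5 i ∩ U).card + 1 := by
  rw [← Finset.card_insert_of_notMem (a := 1) (s := Finset.Icc 5 i ∩ U) (by simp)]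
  congr 1
  ext y
  have := hU y
  simp only [Finset.mem_inter, Finset.mem_insert, Finset.mem_Icc]
  by_cases hy : y ∈ U <;> simp [hy] at this ⊢ <;> omega

theorem card_sdiff_insert_one {i : ℕ} (hi : 4 ≤ i) {U : Finset ℕ} (hU : ∀ y ∈ U, 5 ≤ y) :
    (Finset.Icc 1 i \ insert 1 U).card = (Finset.Icc 5 i \ U).card + 3 := by
  have h : Finset.Icc 1 i \ insert 1 U = Finset.Icc 2 4 ∪ (Finset.Icc 5 i \ U) := by
    ext y
    have := hU y
    simp only [Finset.mem_sdiff, Finset.mem_insert, Finset.mem_Icc, Finset.mem_union]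
    by_cases hy : y ∈ U <;> simp [hy] at this ⊢ <;> omega
  rw [h, Finset.card_union_of_disjoint]
  · simp; omega
  · rw [Finset.disjoint_left]
    intro y hy hy'
    simp at hy hy'
    omega

/-- At i = 4 the count is 1 against 3, a lead of 2; this is the starting height. -/
theorem card_condition_iff (r : List Bool) :
    (∀ i, 4 ≤ i → i ≤ 5 + r.length →
      (Finset.Icc 1 i ∩ insert 1 (markSet 5 (r.map not))).card <
        (Finset.Icc 1 i \ insert 1 (markSet 5 (r.map not))).card) ↔ ResistantWord 2 r := by
  have hU : ∀ y ∈ markSet 5 (r.map not), 5 ≤ y := fun y hy => (bounds_of_mem_markSet _ hy).1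
  rw [resistantWord_iff r 5 2]
  constructor
  · intro h i hi hi'
    have := h i (by omega) hi'
    rw [card_inter_insert_one (by omega) hU, card_sdiff_insert_one (by omega) hU] at this
    omega
  · intro h i hi hi'
    rw [card_inter_insert_one hi hU, card_sdiff_insert_one hi hU]
    rcases Nat.eq_or_lt_of_le hi with rfl | hlt
    · simp
    · have := h i hlt hi'
      omega

theorem IsResistantPair.exists_word {n k : ℕ} {S T : Finset ℕ} (h : IsResistantPair n k S T) :
    ∃ u, IsResistantStart u ∧ T = markSet 2 u ∧ S = insert 1 (markSet 2 (u.map not)) ∧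
      u.count true + 1 ≤ k ∧ u.count false + 2 ≤ k := by
  obtain ⟨j, hj, hST, h⟩ := h
  obtain ⟨u, hlen, rfl, rfl⟩ := hST.exists_word
  refine ⟨u, ?_, rfl, rfl, hST.count_le⟩
  rcases h with h | ⟨-, h⟩
  · right
    -- The inequality at i = 4 leaves room for one element of S in [4], and 1 is already there.
    have hnot : ∀ y, 2 ≤ y → y ≤ 4 → y ∉ insert 1 (markSet 2 (u.map not)) := by
      intro y hy hy' hmem
      have h4 := h 4 le_rfl hj
      have hsum := Finset.card_inter_add_card_sdiff (Finset.Icc 1 4)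
        (insert 1 (markSet 2 (u.map not)))
      have hsub : ({1, y} : Finset ℕ) ⊆ Finset.Icc 1 4 ∩ insert 1 (markSet 2 (u.map not)) := by
        intro z hz
        simp only [Finset.mem_insert, Finset.mem_singleton] at hz
        rcases hz with rfl | rfl
        · simp
        · exact Finset.mem_inter.2 ⟨Finset.mem_Icc.2 ⟨by omega, hy'⟩, hmem⟩
      have hcard := Finset.card_le_card hsub
      rw [Finset.card_pair (by omega)] at hcard
      simp only [Nat.card_Icc] at hsum
      omega
    have h2 := hnot 2 (by norm_num) (by norm_num)
    have h3 := hnot 3 (by norm_num) (by norm_num)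
    have h4 := hnot 4 (by norm_num) (by norm_num)
    rcases u with _ | ⟨_ | _, _ | ⟨_ | _, _ | ⟨_ | _, r⟩⟩⟩ <;> simp [markSet] at h2 h3 h4 hlen
    refine ⟨r, rfl, (card_condition_iff r).1 fun i hi hi' => ?_⟩
    exact h i hi (by omega)
  · left
    exact markSet_injective 2 (h.trans (by decide))

theorem isResistantPair_markSet {n k : ℕ} (hn : 2 * k < n) {u : List Bool}
    (hu : IsResistantStart u) (hT : u.count true + 1 ≤ k) (hS : u.count false + 2 ≤ k) :
    IsResistantPair n k (insert 1 (markSet 2 (u.map not))) (markSet 2 u) := by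
  refine ⟨2 + u.length, ?_, isStrongPair_markSet hn hT hS, ?_⟩
  · rcases hu with rfl | ⟨r, rfl, -⟩ <;> simp
    omega
  · rcases hu with rfl | ⟨r, rfl, hr⟩
    · right
      exact ⟨by decide, by decide⟩
    · left
      intro i hi hi'
      refine (card_condition_iff r).2 hr i hi ?_
      simp at hi'
      omega

/-! ### Neutral sets and words -/

theorem zigzag_append (i : ℕ) : zigzag i ++ [true, false] = zigzag (i + 1) := by
  induction i with
  | zero => rfl
  | succ i ih => rw [zigzag, List.cons_append, List.cons_append, ih]; rfl

theorem count_zigzag (i : ℕ) (c : Bool) : (zigzag i).count c = i := by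
  induction i with
  | zero => rfl
  | succ i ih => cases c <;> simp [zigzag, ih]

theorem markSet_append_true_replicate (w : List Bool) (e : ℕ) : ∀ x : ℕ,
    markSet x (w ++ true :: List.replicate e false) =
      insert (x + w.length + 1 + e) (markSet x w) := by
  have h : ∀ e x, markSet x (List.replicate e false) = {x + e} := by
    intro e
    induction e with
    | zero => intro x; rfl
    | succ e ih =>
      intro x
      rw [List.replicate_succ, markSet, ih, show x + 1 + e = x + (e + 1) by omega]
  induction w with
  | nil =>
    intro x
    change insert x (markSet (x + 1) (List.replicate e false)) = insert (x + 1 + e) {x}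
    rw [h, Finset.pair_comm]
  | cons c w ih =>
    intro x
    have hx : x + 1 + w.length + 1 + e = x + (c :: w).length + 1 + e := by
      simp only [List.length_cons]; omega
    cases c
    · rw [List.cons_append, markSet, ih, hx, markSet]
    · rw [List.cons_append, markSet, ih, hx, markSet, Finset.insert_comm]

/-- The old top element becomes a letter `true`, and the gap up to the new top element is filled
with e letters `false`. -/
theorem insert_two_mul_card_markSet {w : List Bool} {e : ℕ}
    (he : w.count true = w.count false + 1 + e) :
    insert (2 * (markSet 2 w).card) (markSet 2 w) =
      markSet 2 (w ++ true :: List.replicate e false) := by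
  rw [markSet_append_true_replicate, card_markSet, length_eq_count]
  congr 1
  omega

/-- The hypothesis puts 2|T| above the top element. After the first step `true` leads `false` by
exactly 2, so each later step appends `true false`. -/
theorem isNeutralSet_markSet_iff {u w : List Bool} (hu : u.count false + 1 ≤ u.count true) :
    IsNeutralSet (markSet 2 u) (markSet 2 w) ↔
      w = u ∨ ∃ e i, u.count true = u.count false + 1 + e ∧
        w = u ++ true :: (List.replicate e false ++ zigzag i) := by
  have hstep : ∀ e i, u.count true = u.count false + 1 + e →
      insert (2 * (markSet 2 (u ++ true :: (List.replicate e false ++ zigzag i))).card)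
        (markSet 2 (u ++ true :: (List.replicate e false ++ zigzag i))) =
      markSet 2 (u ++ true :: (List.replicate e false ++ zigzag (i + 1))) := by
    intro e i he
    rw [insert_two_mul_card_markSet (e := 1), ← zigzag_append]
    · simp
    · simp [List.count_append, count_zigzag, List.count_replicate]
      omega
  constructor
  · have key : ∀ T, IsNeutralSet (markSet 2 u) T → ∃ w, T = markSet 2 w ∧
        (w = u ∨ ∃ e i, u.count true = u.count false + 1 + e ∧
          w = u ++ true :: (List.replicate e false ++ zigzag i)) := by
      intro T hT
      induction hT with
      | base => exact ⟨u, rfl, Or.inl rfl⟩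
      | step T _ ih =>
        obtain ⟨w, rfl, rfl | ⟨e, i, he, rfl⟩⟩ := ih
        · obtain ⟨e, he⟩ := Nat.exists_eq_add_of_le hu
          have he' : w.count true = w.count false + 1 + e := by omega
          exact ⟨_, insert_two_mul_card_markSet he', Or.inr ⟨e, 0, he', by simp [zigzag]⟩⟩
        · exact ⟨_, hstep e i he, Or.inr ⟨e, i + 1, he, rfl⟩⟩
    intro h
    obtain ⟨w', hw', h⟩ := key _ h
    rwa [markSet_injective 2 hw']
  · rintro (rfl | ⟨e, i, he, rfl⟩)
    · exact IsNeutralSet.base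
    · induction i with
      | zero =>
        have := IsNeutralSet.step (markSet 2 u) IsNeutralSet.base
        rw [insert_two_mul_card_markSet he] at this
        simpa [zigzag] using this
      | succ i ih =>
        have := IsNeutralSet.step _ ih
        rwa [hstep e i he] at this

/-! ### The least resistant pair above a strong pair -/

/-- After three letters `true` the parameters are M = n-4, a = k-1, b = k-3, so the height is 2. If
nothing resistant lies above the rest, the exceptional word `[true, true]` is least, and its excess
over the common terms is exactly the threshold C(M,b). -/
theorem exists_least_resistantStart {n k : ℕ} (hn : 2 * k < n) {w : List Bool}
    (hT : w.count true + 1 ≤ k) (hS : w.count false + 2 ≤ k)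
    (hw : ∃ u, IsResistantStart u ∧ WordLE w u) :
    ∃ r, IsResistantStart r ∧ r.count true + 1 ≤ k ∧ r.count false + 1 ≤ r.count true ∧
      WordLE w r ∧ (∀ u, IsResistantStart u → WordLE w u → WordLE r u) ∧
      (pairCount (n - 1) (k - 1) k w = pairCount (n - 1) (k - 1) k r ↔
        w = r ∨ ∃ e i, r.count true = r.count false + 1 + e ∧
          w = r ++ true :: (List.replicate e false ++ zigzag i)) := by
  have hw' : w = [true, true] ∨ ∃ v, w = true :: true :: true :: v := by
    obtain ⟨u, rfl | ⟨r, rfl, -⟩, h⟩ := hw <;>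
    rcases w with _ | ⟨_ | _, _ | ⟨_ | _, _ | ⟨_ | _, v⟩⟩⟩ <;> simp [WordLE] at h ⊢
  rcases hw' with rfl | ⟨v, rfl⟩
  · exact ⟨_, Or.inl rfl, hT, by simp, by simp [WordLE], fun u _ h => h, by simp⟩
  simp at hT hS
  obtain ⟨b, rfl⟩ : ∃ b, k = b + 3 := ⟨k - 3, by omega⟩
  obtain ⟨M, rfl⟩ : ∃ M, n = M + 4 := ⟨n - 4, by omega⟩
  have hG : ∀ v, pairCount (M + 4 - 1) (b + 3 - 1) (b + 3) (true :: true :: true :: v) =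
      (M + 2).choose (b + 1) + ((M + 1).choose (b + 1) + (M.choose (b + 1) +
        pairCount M (b + 2) b v)) := by
    intro v; simp only [pairCount_true]; rfl
  rcases exists_least_resistantWord v 2 b M (by norm_num) (by omega) (by omega) (by omega) with
    ⟨h1, h2, h3⟩ | ⟨r, h1, h2, h3, h4, h5⟩
  · refine ⟨[true, true], Or.inl rfl, by simp, by simp, by simp [WordLE], ?_, ?_⟩
    · rintro u (rfl | ⟨r, rfl, hr⟩) h
      · simp [WordLE]
      · exact absurd h (h1 r hr)
    · have hE : pairCount (M + 4 - 1) (b + 3 - 1) (b + 3) [true, true] =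
          (M + 2).choose (b + 1) + ((M + 1).choose (b + 1) + (M.choose (b + 1) +
            M.choose b)) := by
        simp only [pairCount_true, pairCount_nil]; rfl
      rw [hG, hE, Nat.add_left_cancel_iff, Nat.add_left_cancel_iff, Nat.add_left_cancel_iff, h3]
      constructor
      · rintro ⟨i, rfl⟩
        exact Or.inr ⟨1, i, rfl, rfl⟩
      · rintro (h | ⟨e, i, he, h⟩)
        · simp at h
        · obtain rfl : e = 1 := by simp at he; omega
          exact ⟨i, by simpa using h⟩
  · have hc := h1.count_le
    refine ⟨true :: true :: true :: r, Or.inr ⟨r, rfl, h1⟩, by simp; omega, by simp; omega, h3, ?_, ?_⟩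
    · rintro u (rfl | ⟨r', rfl, hr⟩) h
      · simp [WordLE]
      · exact h4 r' hr h
    · rw [hG, hG, Nat.add_left_cancel_iff, Nat.add_left_cancel_iff, Nat.add_left_cancel_iff, h5,
        NeutralWord]
      have hce : ∀ e, (2 + r.count true = r.count false + e ↔
          (true :: true :: true :: r).count true =
            (true :: true :: true :: r).count false + 1 + e) := by
        intro e; simp; omega
      simp only [hce, List.cons.injEq, true_and, List.cons_append]

end LexPairs

open LexPairs in
theorem mainTheorem10 (n k : ℕ) (hk : 6 ≤ 2 * k) (hn : 2 * k < n)
    (m : ℕ) (Sr Tr : ℕ → Finset ℕ) (hr : LexPairs.IsResistantEnumeration n k m Sr Tr)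
    (S T : Finset ℕ) (hST : ∃ j, LexPairs.IsStrongPair n k j S T)
    (𝒜 ℬ : Finset (Finset ℕ))
    (hA : 𝒜 = LexPairs.lexFamily n S (k - 1)) (hB : ℬ = LexPairs.lexFamily n T k)
    (l : ℕ) (hl : 1 ≤ l) (hlm : l ≤ m)
    (hlow : LexPairs.LexLT (Tr (l - 1)) T) (hupp : LexPairs.LexLE T (Tr l)) :
    𝒜.card + ℬ.card =
        (LexPairs.lexFamily n (Sr l) (k - 1)).card + (LexPairs.lexFamily n (Tr l) k).card ↔
      LexPairs.IsNeutralPair n k (Tr l) S T := by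
  subst hA hB
  rw [IsNeutralPair, and_iff_right hST]
  obtain ⟨j, hST⟩ := hST
  obtain ⟨w, -, rfl, rfl⟩ := hST.exists_word
  obtain ⟨hwT, hwS⟩ := hST.count_le
  obtain ⟨u, hu, huT, -⟩ := (hr.resistant l hl hlm).exists_word
  rw [huT, lexLE_markSet_iff] at hupp
  obtain ⟨r, hres, hrT, hrS, hwr, hmin, hiff⟩ := exists_least_resistantStart hn hwT hwS ⟨u, hu, hupp⟩
  obtain ⟨q, hq, hqm, hqS, hqT⟩ :=
    hr.complete _ _ (isResistantPair_markSet hn hres hrT (by omega))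
  -- If q < l then T ≤ T_q ≤ T_(l-1) < T; if q > l then minimality gives T_q ≤ T_l < T_q.
  obtain rfl : q = l := by
    rcases lt_trichotomy q l with h | h | h
    · exfalso
      have h1 : LexLE (Tr q) (Tr (l - 1)) := by
        rcases Nat.eq_or_lt_of_le (show q ≤ l - 1 by omega) with h' | h'
        · rw [h']; exact LexLE.refl _
        · exact (hr.increasing q (l - 1) h' (by omega)).1
      rw [hqT] at h1
      exact hlow.2 (hlow.1.antisymm (((lexLE_markSet_iff w 2 r).2 hwr).trans h1))
    · exact h
    · exfalso
      have h1 := hr.increasing l q h hqm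
      have h2 := (lexLE_markSet_iff r 2 u).2 (hmin u hu hupp)
      rw [← hqT, ← huT] at h2
      exact h1.2 (h1.1.antisymm h2)
  rw [hqS, hqT, card_lexFamily_add hn hwT hwS, card_lexFamily_add hn hrT (by omega), hiff,
    isNeutralSet_markSet_iff hrS]
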